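/- Let $\mathbb K$ be an algebraically closed field of characteristic zero, let $e\ge 10$ and $2\le n\le e-2$ be integers, and let $S(e,1,n)=\langle\{e,e+1,\dots,2e-1\}\setminus\{e+1,e+n\}\rangle\subseteq\mathbb N$. Let $R=\mathbb K[\{x_0,\dots,x_{e-1}\}\setminus\{x_1,x_n\}]$, and let the defining ideal $I_{S(e,1,n)}$ be the kernel of the $\mathbb K$-algebra homomorphism $R\to\mathbb K[S(e,1,n)]\subseteq\mathbb K[t]$, $x_i\mapsto t^{e+i}$. Consider the matrices $$A_n=\begin{bmatrix}x_2&x_3&\cdots&x_{n-2}&x_{n+1}&x_{n+2}&\cdots&x_{e-2}&x_{e-1}\\ x_3&x_4&\cdots&x_{n-1}&x_{n+2}&x_{n+3}&\cdots&x_{e-1}&x_0^2\end{bmatrix},\qquad B_2=\begin{bmatrix}x_0&x_3&\cdots&x_{e-4}&x_{e-3}\\ x_3&x_6&\cdots&x_{e-1}&x_0^2\end{bmatrix},$$ $$B_n=\begin{bmatrix}x_0&x_2&\cdots&x_{n-3}&x_{n-1}&x_{n+1}&\cdots&x_{e-3}&x_{e-2}\\ x_2&x_4&\cdots&x_{n-1}&x_{n+1}&x_{n+3}&\cdots&x_{e-1}&x_0^2\end{bmatrix}\quad(n\ge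 3).$$ Precisely: the columns of $A_n$ are, in increasing order of $i$, the columns $(x_i,x_{i+1})^T$ for $2\le i\le e-2$, $i\ne n-1,n$, followed by $(x_{e-1},x_0^2)^T$. The columns of $B_2$ are $(x_0,x_3)^T$, then $(x_i,x_{i+3})^T$ for $3\le i\le e-4$, then $(x_{e-3},x_0^2)^T$. For $n\ge3$ the columns of $B_n$ are $(x_0,x_2)^T$, then $(x_i,x_{i+2})^T$ for $2\le i\le e-3$, $i\ne n-2,n$, then, only if $n\ne e-2$, $(x_{e-2},x_0^2)^T$. Let $J_n$ be the set of all $2\times2$ minors of $A_n$, and let $K_n$ be the set of all $2\times 2$ minors of $B_n$ that involve its first column. Define $L_{e,n}\subseteq R$ as follows. 1. $L_{e,2}=\emptyset$. 2. $L_{e,3}=\{x_4x_{4+i}-x_2x_{6+i}\mid 0\le i\le e-7\}\cup\{x_0^2x_2-x_4x_{e-2}\}$. 3. $L_{e,4}=\{x_5x_{5+i}-x_3x_{7+i}\mid 0\le i\le e-8\}\cup\{x_3^2-x_0x_6\}\cup\{x_0^2x_3-x_5x_{e-2},\ x_0x_2^2-x_5x_{e-1},\ x_2^3-x_7x_{e-1}\}$.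 4. For $5\le n\le e-4$, $L_{e,n}=\{x_{n+1}x_{n+1+i}-x_{n-1}x_{n+3+i}\mid 0\le i\le e-n-4\}\cup\{x_{n-1}x_{n-1-i}-x_{n+1}x_{n-3-i}\mid 0\le i\le n-5\}\cup\{x_{n-1}x_3-x_{n+2}x_0\}\cup\{x_0^2x_{n-1}-x_{n+1}x_{e-2},\ x_0x_2x_{n-2}-x_{n+1}x_{e-1}\}$. 5. $L_{e,e-3}=\{x_{e-4}x_{e-4-i}-x_{e-2}x_{e-6-i}\mid 0\le i\le e-8\}\cup\{x_{e-4}x_3-x_0x_{e-1}\}\cup\{x_0^2x_{e-4}-x_{e-2}^2,\ x_0x_2x_{e-5}-x_{e-2}x_{e-1}\}$. 6. $L_{e,e-2}=\{x_{e-3}x_{e-3-i}-x_{e-1}x_{e-5-i}\mid 0\le i\le e-7\}\cup\{x_0^3-x_3x_{e-3},\ x_0x_2x_{e-4}-x_{e-1}^2\}$. Then $J_n\cup K_n\cup L_{e,n}$ is a minimal generating set of $I_{S(e,1,n)}$: it generates $I_{S(e,1,n)}$, and no proper subset of it does. -/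

import Mathlib

noncomputable section

namespace SallyType

/-- The numerical semigroup `S(e,m,n) = ⟨{e, e+1, …, 2e-1} \ {e+m, e+n}⟩`. -/
def S (e m n : ℕ) : AddSubmonoid ℕ :=
  AddSubmonoid.closure (Set.Icc e (2 * e - 1) \ {e + m, e + n})

/-- The index set `{0, …, e-1} \ {m, n}` of the variables. -/
abbrev Idx (e m n : ℕ) : Type := {i : ℕ // i < e ∧ i ≠ m ∧ i ≠ n}

/-- The polynomial ring `R(e,m,n) = K[{x_0, …, x_{e-1}} \ {x_m, x_n}]`. -/
abbrev R (K : Type*) [Field K] (e m n : ℕ) : Type _ := MvPolynomial (Idx e m n) K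

theorem add_mem_S {e m n : ℕ} (i : Idx e m n) : e + i.1 ∈ S e m n := by
  apply AddSubmonoid.subset_closure
  obtain ⟨i, hi, hm, hn⟩ := i
  simp only [Set.mem_sdiff, Set.mem_Icc, Set.mem_insert_iff, Set.mem_singleton_iff]
  omega

/-- The canonical map `R(e,m,n) → K[S(e,m,n)]`, `x_i ↦ t^(e+i)`, where the semigroup ring
`K[S] = ⨁_{s ∈ S} K t^s` is the additive monoid algebra of `S`. -/
def toSemigroupRing (K : Type*) [Field K] (e m n : ℕ) :
    R K e m n →ₐ[K] AddMonoidAlgebra K (S e m n) :=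
  MvPolynomial.aeval fun i : Idx e m n =>
    AddMonoidAlgebra.single (⟨e + i.1, add_mem_S i⟩ : S e m n) (1 : K)

/-- The defining ideal `I_{S(e,m,n)}`. -/
def definingIdeal (K : Type*) [Field K] (e m n : ℕ) : Ideal (R K e m n) :=
  RingHom.ker (toSemigroupRing K e m n)

/-- The variable `x_i` of `R(e,m,n)`, addressed by a natural number `i`. It is only used for
`i ∈ {0, …, e-1} \ {m, n}`; the value `0` elsewhere is a placeholder. -/
def x (K : Type*) [Field K] (e m n i : ℕ) : R K e m n :=
  if h : i < e ∧ i ≠ m ∧ i ≠ n then MvPolynomial.X ⟨i, h⟩ else 0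

theorem x_eq_X (K : Type*) [Field K] {e m n : ℕ} (i : Idx e m n) :
    x K e m n i.1 = MvPolynomial.X i := by
  simp only [x, dif_pos i.2]

section Matrices

variable (K : Type*) [Field K] (e n : ℕ)

/-- The columns of `A_n`, labelled by the index of their top entry:
`2, …, n-2, n+1, …, e-1`. -/
abbrev ACol : Type := {i : ℕ // 2 ≤ i ∧ i ≤ e - 1 ∧ i ≠ n - 1 ∧ i ≠ n}

/-- The matrix `A_n`. The column with top entry `x_i` has bottom entry `x_{i+1}`, except that the
last column is `(x_{e-1}, x_0^2)`. -/
def A : Matrix (Fin 2) (ACol e n) (R K e 1 n) := fun r i =>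
  if r = 0 then x K e 1 n i.1
  else if i.1 = e - 1 then x K e 1 n 0 ^ 2
  else x K e 1 n (i.1 + 1)

/-- The columns of `B_n`, labelled by the index of their top entry: `0, 3, 4, …, e-3` if `n = 2`,
and `0, 2, …, n-3, n-1, n+1, …, e-2` if `n ≥ 3` (in particular a column with top entry `x_{e-2}`
is present only if `n ≠ e-2`). -/
abbrev BCol : Type :=
  {i : ℕ // i = 0 ∨ (n = 2 ∧ 3 ≤ i ∧ i ≤ e - 3) ∨
    (3 ≤ n ∧ 2 ≤ i ∧ i ≤ e - 2 ∧ i ≠ n - 2 ∧ i ≠ n)}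

/-- The first column of `B_n`. -/
def BCol.first : BCol e n := ⟨0, Or.inl rfl⟩

/-- The matrix `B_n`. For `n = 2` the column with top entry `x_i` has bottom entry `x_{i+3}`, except
that the last column is `(x_{e-3}, x_0^2)`. For `n ≥ 3` the column with top entry `x_i` has bottom
entry `x_{i+2}`, except that the column with top entry `x_{e-2}` is `(x_{e-2}, x_0^2)`. -/
def B : Matrix (Fin 2) (BCol e n) (R K e 1 n) := fun r i =>
  if r = 0 then x K e 1 n i.1
  else if n = 2 then
    if i.1 = e - 3 then x K e 1 n 0 ^ 2 else x K e 1 n (i.1 + 3)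
  else
    if i.1 = e - 2 then x K e 1 n 0 ^ 2 else x K e 1 n (i.1 + 2)

/-- `J_n`: all `2 × 2` minors of `A_n`. -/
def J : Set (R K e 1 n) :=
  {f | ∃ c d : ACol e n, c < d ∧ f = ((A K e n).submatrix id ![c, d]).det}

/-- `K_n`: all `2 × 2` minors of `B_n` that involve its first column. -/
def Kset : Set (R K e 1 n) :=
  {f | ∃ d : BCol e n, BCol.first e n < d ∧
    f = ((B K e n).submatrix id ![BCol.first e n, d]).det}

/-- The list `L_{e,n}`, for `e ≥ 10` and `2 ≤ n ≤ e - 2`. -/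
def L : Set (R K e 1 n) :=
  let x := x K e 1 n
  if n = 2 then ∅
  else if n = 3 then
    {f | ∃ i ≤ e - 7, f = x 4 * x (4 + i) - x 2 * x (6 + i)} ∪
    {x 0 ^ 2 * x 2 - x 4 * x (e - 2)}
  else if n = 4 then
    {f | ∃ i ≤ e - 8, f = x 5 * x (5 + i) - x 3 * x (7 + i)} ∪
    {x 3 ^ 2 - x 0 * x 6} ∪
    {x 0 ^ 2 * x 3 - x 5 * x (e - 2), x 0 * x 2 ^ 2 - x 5 * x (e - 1),
      x 2 ^ 3 - x 7 * x (e - 1)}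
  else if n ≤ e - 4 then
    {f | ∃ i ≤ e - n - 4, f = x (n + 1) * x (n + 1 + i) - x (n - 1) * x (n + 3 + i)} ∪
    {f | ∃ i ≤ n - 5, f = x (n - 1) * x (n - 1 - i) - x (n + 1) * x (n - 3 - i)} ∪
    {x (n - 1) * x 3 - x (n + 2) * x 0} ∪
    {x 0 ^ 2 * x (n - 1) - x (n + 1) * x (e - 2),
      x 0 * x 2 * x (n - 2) - x (n + 1) * x (e - 1)}
  else if n = e - 3 then
    {f | ∃ i ≤ e - 8, f = x (e - 4) * x (e - 4 - i) - x (e - 2) * x (e - 6 - i)} ∪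
    {x (e - 4) * x 3 - x 0 * x (e - 1)} ∪
    {x 0 ^ 2 * x (e - 4) - x (e - 2) ^ 2,
      x 0 * x 2 * x (e - 5) - x (e - 2) * x (e - 1)}
  else
    {f | ∃ i ≤ e - 7, f = x (e - 3) * x (e - 3 - i) - x (e - 1) * x (e - 5 - i)} ∪
    {x 0 ^ 3 - x 3 * x (e - 3), x 0 * x 2 * x (e - 4) - x (e - 1) ^ 2}

end Matrices

end SallyType

end

/-!
# A minimal generating set of the defining ideal of `S(e,1,n)`

Both halves of the theorem are about binomials, that is, about pairs of monomials of equal degree.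

*Generation.* The semigroup ring is free over `K[x_0]` on the Apéry set of `S(e,1,n)` with respect
to `e`, which has one element for every residue class modulo `e`: the degree `0` of `1`, the degrees
`e + i` of the variables `x_i`, and in the classes of `1` and `n` the degrees of two further
quadratic monomials. So it is enough to bring every monomial, modulo the listed binomials, into the
form `x_0 ^ k * u` with `u` from this list of `e` monomials (`IsNF`): such a normal form is determined
by its degree (`IsNF.unique`), hence monomials of equal degree agree modulo the listed binomials, and
the quotient map factors through the semigroup ring (`definingIdeal_le_span`). By induction it
suffices to multiply a normal form by one variable (`Rels.isNF_var_mul`). The quadratic case is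
`Rels.mul_eq_pairNF`: the minors of `A_n` identify the products `x_a x_b` of equal index sum inside
each of three groups (both factors below `n`, both above, one on either side), and the minors of
`B_n` with the list `L_{e,n}` tie these groups together and to multiples of `x_0`. In the cubic case
one refactors `u` such that multiplication by the variable first gives a power of `x_0` times a
variable. The single exception is `x_2 ^ 3` for `n = 4`, which has a binomial of its own.

*Irredundancy.* Every listed binomial has a leading monomial, quadratic except for `x_2 ^ 3` if
`n = 4`, and no proper divisor of a leading monomial occurs in any of the binomials. Therefore, in an
expression of one binomial in terms of others, only the constant terms of the coefficients matter at
the leading monomials. The leading monomials are pairwise distinct and the matrix of coefficients at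
them is triangular for a suitable weight (`Fam.unique`, `Fam.weight_lt`), so there is no such
expression (`mem_of_mem_span_of_triangular`).
-/

namespace SallyType

open MvPolynomial

/-! ### Irredundancy from triangular leading monomials -/

/-- If no monomial properly dividing `m` occurs in `g`, the coefficient of `m` in a multiple of `g`
only sees the constant term of the multiplier. -/
theorem coeff_mul_of_forall_lt {σ K : Type*} [Field K] {m : σ →₀ ℕ} {g : MvPolynomial σ K}
    (hg : ∀ m' < m, coeff m' g = 0) (c : MvPolynomial σ K) :
    coeff m (c * g) = coeff 0 c * coeff m g := by
  classical
  rw [coeff_mul, Finset.sum_eq_single (0, m)]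
  · rintro ⟨u, v⟩ huv hne
    rw [Finset.HasAntidiagonal.mem_antidiagonal] at huv
    simp only at huv ⊢
    rw [hg v, mul_zero]
    refine lt_of_le_of_ne (huv ▸ le_add_self) ?_
    rintro rfl
    exact hne (by simpa using huv)
  · simp

/-- A criterion for the irredundancy of a family `g` of polynomials. Every `g p` has a leading
monomial `l p`; these are triangular with respect to the weight `w`, and no proper divisor of a
leading monomial occurs in the family. Then a member of the family that lies in the ideal spanned
by some members is one of them. -/
theorem mem_of_mem_span_of_triangular {σ K ι : Type*} [Field K] {P : Set ι}
    {g : ι → MvPolynomial σ K} {l : ι → σ →₀ ℕ} {w : ι → ℕ}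
    (hlead : ∀ p ∈ P, coeff (l p) (g p) ≠ 0)
    (htri : ∀ p ∈ P, ∀ q ∈ P, p ≠ q → coeff (l p) (g q) ≠ 0 → w p < w q)
    (hdiv : ∀ p ∈ P, ∀ q ∈ P, ∀ m < l p, coeff m (g q) = 0)
    {T : Set (MvPolynomial σ K)} (hT : T ⊆ g '' P) {p : ι} (hp : p ∈ P)
    (hmem : g p ∈ Ideal.span T) : g p ∈ T := by
  classical
  by_contra hpT
  obtain ⟨P', hP', rfl⟩ : ∃ P' ⊆ P, g '' P' = T := Set.subset_image_iff.1 hT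
  have hpP' : p ∉ P' := fun h => hpT ⟨p, h, rfl⟩
  obtain ⟨c, hc, hsum⟩ := (Finsupp.mem_span_image_iff_linearCombination _).1 hmem
  rw [Finsupp.mem_supported] at hc
  have hcoeff : ∀ r ∈ P, coeff (l r) (g p) =
      ∑ q ∈ c.support, coeff 0 (c q) * coeff (l r) (g q) := by
    intro r hr
    rw [← hsum, Finsupp.linearCombination_apply, Finsupp.sum, coeff_sum]
    refine Finset.sum_congr rfl fun q hq => ?_
    exact coeff_mul_of_forall_lt (hdiv r hr q (hP' (hc hq))) _
  obtain ⟨r, hrF, hmax⟩ := (insert p (c.support.filter fun q => coeff 0 (c q) ≠ 0)).exists_max_image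
    w ⟨p, Finset.mem_insert_self _ _⟩
  have hbig : ∀ q ∈ c.support, coeff 0 (c q) ≠ 0 → w q ≤ w r := fun q hq hq0 =>
    hmax q (Finset.mem_insert_of_mem (Finset.mem_filter.2 ⟨hq, hq0⟩))
  rcases eq_or_ne r p with rfl | hrp
  · refine hlead r hp ?_
    rw [hcoeff r hp]
    refine Finset.sum_eq_zero fun q hq => ?_
    by_contra hne
    have hqr : r ≠ q := fun h => hpP' (h ▸ hc hq)
    exact absurd (htri r hp q (hP' (hc hq)) hqr (right_ne_zero_of_mul hne))
      (not_lt.2 (hbig q hq (left_ne_zero_of_mul hne)))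
  · have hr := (Finset.mem_insert.1 hrF).resolve_left hrp
    rw [Finset.mem_filter] at hr
    have hrP := hP' (hc hr.1)
    have h0 : coeff (l r) (g p) = 0 := by
      by_contra hne
      exact absurd (htri r hrP p hp hrp hne) (not_lt.2 (hmax p (Finset.mem_insert_self _ _)))
    rw [hcoeff r hrP, Finset.sum_eq_single r _ (fun h => absurd hr.1 h)] at h0
    · exact mul_ne_zero hr.2 (hlead r hrP) h0
    · intro q hq hqr
      by_contra hne
      exact absurd (htri r hrP q (hP' (hc hq)) hqr.symm (right_ne_zero_of_mul hne))
        (not_lt.2 (hbig q hq (left_ne_zero_of_mul hne)))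

/-! ### Normal forms of monomials -/

section Slides

variable {Q : Type*} [CommRing Q] {Y : ℕ → Q}

/-- Moving the two indices of a product towards each other inside one interval: all products of two
entries with the same index sum coincide. -/
theorem mul_eq_mul_of_slide {p q : ℕ}
    (h : ∀ i j, p ≤ i → i < j → j < q → Y i * Y (j + 1) = Y (i + 1) * Y j) {a b c d : ℕ}
    (ha : p ≤ a ∧ a ≤ q) (hb : p ≤ b ∧ b ≤ q) (hc : p ≤ c ∧ c ≤ q) (hd : p ≤ d ∧ d ≤ q)
    (hs : a + b = c + d) : Y a * Y b = Y c * Y d := by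
  have key : ∀ k a b : ℕ, b - a = k → p ≤ a → a ≤ b → b ≤ q →
      Y a * Y b = Y ((a + b) / 2) * Y (a + b - (a + b) / 2) := by
    intro k
    induction k using Nat.strong_induction_on with
    | _ k ih =>
      intro a b hk hpa hab hbq
      by_cases h1 : b ≤ a + 1
      · rw [show (a + b) / 2 = a by omega, show a + b - a = b by omega]
      · obtain ⟨j, rfl⟩ : ∃ j, b = j + 1 := ⟨b - 1, by omega⟩
        rw [h a j hpa (by omega) (by omega),
          ih (j - (a + 1)) (by omega) (a + 1) j rfl (by omega) (by omega) (by omega),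
          show a + 1 + j = a + (j + 1) by omega]
  have key' : ∀ a b : ℕ, p ≤ a → a ≤ q → p ≤ b → b ≤ q →
      Y a * Y b = Y ((a + b) / 2) * Y (a + b - (a + b) / 2) := by
    intro a b h1 h2 h3 h4
    rcases le_total a b with hab | hab
    · exact key _ a b rfl h1 hab h4
    · rw [mul_comm, add_comm a b]
      exact key _ b a rfl h3 hab h2
  rw [key' a b ha.1 ha.2 hb.1 hb.2, key' c d hc.1 hc.2 hd.1 hd.2, hs]

/-- The same with the two indices in two different intervals. -/
theorem mul_eq_mul_of_slide_of_slide {p q p' q' : ℕ}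
    (h : ∀ i j, p ≤ i → i < q → p' ≤ j → j < q' → Y i * Y (j + 1) = Y (i + 1) * Y j) {a b c d : ℕ}
    (ha : p ≤ a ∧ a ≤ q) (hb : p' ≤ b ∧ b ≤ q') (hc : p ≤ c ∧ c ≤ q) (hd : p' ≤ d ∧ d ≤ q')
    (hs : a + b = c + d) : Y a * Y b = Y c * Y d := by
  have key : ∀ k a b : ℕ, p ≤ a → a + k ≤ q → p' ≤ b → b + k ≤ q' →
      Y a * Y (b + k) = Y (a + k) * Y b := by
    intro k
    induction k with
    | zero => intros; rfl
    | succ k ih =>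
      intro a b h1 h2 h3 h4
      rw [← add_assoc b k 1, h a (b + k) h1 (by omega) (by omega) (by omega),
        ih (a + 1) b (by omega) (by omega) (by omega) (by omega),
        show a + 1 + k = a + (k + 1) by omega]
  rcases le_total a c with hac | hac
  · obtain ⟨k, rfl⟩ := Nat.exists_eq_add_of_le hac
    obtain rfl : b = d + k := by omega
    exact key k a d ha.1 hc.2 hd.1 hb.2
  · obtain ⟨k, rfl⟩ := Nat.exists_eq_add_of_le hac
    obtain rfl : d = b + k := by omega
    exact (key k c b hc.1 ha.2 hb.1 hd.2).symm

end Slides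

/-- The relations which the generators in `J_n ∪ K_n ∪ L_{e,n}` impose on a family `Y` of elements of
a commutative ring. The family is extended by `Y e = Y 0 ^ 2`: as `x_0 ^ 2` has degree `e + e`, it
takes the place of a variable `x_e`, and the last columns of the matrices are no exceptions any
more. Likewise `high` with `b = e - 2` is the binomial with the term `x_0 ^ 2 x_{n-1}`, and `three`
is for `n = e - 2` the one with the term `x_0 ^ 3`. -/
structure Rels {Q : Type*} [CommRing Q] (e n : ℕ) (Y : ℕ → Q) : Prop where
  top : Y e = Y 0 ^ 2
  minorA : ∀ i j, 2 ≤ i → i < j → j < e → i ≠ n - 1 → i ≠ n → j ≠ n - 1 → j ≠ n →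
    Y i * Y (j + 1) = Y (i + 1) * Y j
  minorB_two : n = 2 → ∀ j, 3 ≤ j → j + 3 ≤ e → Y 0 * Y (j + 3) = Y 3 * Y j
  minorB : 3 ≤ n → ∀ j, 2 ≤ j → j + 2 ≤ e → j ≠ n - 2 → j ≠ n → Y 0 * Y (j + 2) = Y 2 * Y j
  high : 3 ≤ n → ∀ b, n + 1 ≤ b → b + 2 ≤ e → Y (n + 1) * Y b = Y (n - 1) * Y (b + 2)
  low : ∀ a, 4 ≤ a → a < n → Y (n - 1) * Y a = Y (n + 1) * Y (a - 2)
  three : 4 ≤ n → Y 3 * Y (n - 1) = Y 0 * Y (n + 2)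
  cubic : 4 ≤ n → Y 0 * Y 2 * Y (n - 2) = Y (n + 1) * Y (e - 1)
  cube : n = 4 → Y 2 ^ 3 = Y 7 * Y (e - 1)

section NormalForm

variable {Q : Type*} [CommRing Q]

/-- The quotient by `e` of the element of the Apéry set of `S(e,1,n)` that is congruent to `r` modulo
`e`; that element is `e * aperyQuot n r + r`. -/
def aperyQuot (n r : ℕ) : ℕ :=
  if r = 0 then 0 else if r = 1 then 3 else if r = n then (if n ≤ 3 then 3 else 2) else 1

/-- The normal form, not divisible by `x_0`, in the residue class `r` modulo `e`; its degree is
`e * aperyQuot n r + r`, the element of the Apéry set in that class. The classes of `1` and `n`,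
in which no variable has its degree, are represented by products of two variables. -/
def aperyMon (e n : ℕ) (Y : ℕ → Q) (r : ℕ) : Q :=
  if r = 0 then 1
  else if r = 1 then (if n = 2 then Y 3 * Y (e - 2) else Y 2 * Y (e - 1))
  else if r = n then (if n ≤ 3 then Y (n + 1) * Y (e - 1) else Y 2 * Y (n - 2))
  else Y r

/-- `z` is the normal form of degree `d`: the power of `x_0` times the entry of `aperyMon` that has
this degree. -/
def IsNF (e n : ℕ) (Y : ℕ → Q) (d : ℕ) (z : Q) : Prop :=
  ∃ k r, r < e ∧ d = e * (k + aperyQuot n r) + r ∧ z = Y 0 ^ k * aperyMon e n Y r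

theorem IsNF.unique {e n : ℕ} {Y : ℕ → Q} {d : ℕ} {z z' : Q} (h : IsNF e n Y d z)
    (h' : IsNF e n Y d z') : z = z' := by
  obtain ⟨k, r, hr, hd, rfl⟩ := h
  obtain ⟨k', r', hr', hd', rfl⟩ := h'
  have e1 : r = r' := by
    have h1 := congrArg (· % e) hd
    have h2 := congrArg (· % e) hd'
    simp only [Nat.mul_add_mod, Nat.mod_eq_of_lt hr, Nat.mod_eq_of_lt hr'] at h1 h2
    omega
  subst e1
  have e2 := Nat.eq_of_mul_eq_mul_left (by omega) (Nat.add_right_cancel (hd.symm.trans hd'))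
  rw [Nat.add_right_cancel e2]

theorem IsNF.pow_mul {e n : ℕ} {Y : ℕ → Q} {d : ℕ} {z : Q} (h : IsNF e n Y d z) (k : ℕ) :
    IsNF e n Y (e * k + d) (Y 0 ^ k * z) := by
  obtain ⟨k', r, hr, rfl, rfl⟩ := h
  exact ⟨k + k', r, hr, by ring, by ring⟩

theorem isNF_one {e n : ℕ} (he : 0 < e) (Y : ℕ → Q) : IsNF e n Y 0 1 :=
  ⟨0, 0, he, by simp [aperyQuot], by simp [aperyMon]⟩

theorem isNF_var {e n : ℕ} (Y : ℕ → Q) {i : ℕ} (hi : i < e) (h1 : i ≠ 1) (hn : i ≠ n) :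
    IsNF e n Y (e + i) (Y i) := by
  rcases Nat.eq_zero_or_pos i with rfl | h0
  · exact ⟨1, 0, hi, by simp [aperyQuot], by simp [aperyMon]⟩
  · refine ⟨0, i, hi, ?_, ?_⟩ <;> simp [aperyQuot, aperyMon, h1, hn, h0.ne']

end NormalForm

section Products

variable {Q : Type*} [CommRing Q] {e n : ℕ} {Y : ℕ → Q}

/-- The normal form of a product of two variables whose index sum is `s`. -/
def pairNF (e n : ℕ) (Y : ℕ → Q) (s : ℕ) : Q :=
  if s = n then aperyMon e n Y n
  else if s ≤ e then Y 0 * Y s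
  else if s = e + 1 then aperyMon e n Y 1
  else if s = e + n then (if n ≤ 3 then aperyMon e n Y n else Y 0 * aperyMon e n Y n)
  else Y e * Y (s - e)

theorem Rels.mul_eq_pairNF_two (h : Rels e 2 Y) (he : 10 ≤ e) {a b : ℕ} (ha : 3 ≤ a) (hab : a ≤ b)
    (hb : b < e) : Y a * Y b = pairNF e 2 Y (a + b) := by
  have slide : ∀ {a b c d : ℕ}, 3 ≤ a ∧ a ≤ e → 3 ≤ b ∧ b ≤ e → 3 ≤ c ∧ c ≤ e → 3 ≤ d ∧ d ≤ e →
      a + b = c + d → Y a * Y b = Y c * Y d := fun h1 h2 h3 h4 hs =>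
    mul_eq_mul_of_slide (fun i j h1 h2 h3 => h.minorA i j (by omega) h2 h3 (by omega) (by omega)
      (by omega) (by omega)) h1 h2 h3 h4 hs
  unfold pairNF
  rw [if_neg (by omega)]
  split_ifs with h1 h2 h3 h4
  · have := h.minorB_two rfl (a + b - 3) (by omega) (by omega)
    rw [show a + b - 3 + 3 = a + b by omega] at this
    rw [this]
    exact slide (by omega) (by omega) (by omega) (by omega) (by omega)
  · simp only [aperyMon, one_ne_zero, if_true, if_false]
    exact slide (by omega) (by omega) (by omega) (by omega) (by omega)
  · simp only [aperyMon, OfNat.ofNat_ne_zero, OfNat.ofNat_ne_one, if_true, if_false]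
    rw [if_pos (by omega)]
    exact slide (by omega) (by omega) (by omega) (by omega) (by omega)
  · omega
  · exact slide (by omega) (by omega) (by omega) (by omega) (by omega)

/-- The matrix `A_n` makes all products coincide that have the same index sum and whose factors come
from the same blocks `[2, n-1]` (low) or `[n+1, e]` (high). The first row of `B_n` and the list
`L_{e,n}` link the three kinds of products (low-low, low-high, high-high) to one another and to
products with `x_0`. -/
theorem Rels.mul_eq_pairNF_of_three_le (h : Rels e n Y) (he : 10 ≤ e) (hn : 3 ≤ n) (hne : n + 2 ≤ e)
    {a b : ℕ} (ha : 2 ≤ a) (hab : a ≤ b) (hb : b < e) (han : a ≠ n) (hbn : b ≠ n) :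
    Y a * Y b = pairNF e n Y (a + b) := by
  have slideLow : ∀ {a b c d : ℕ}, 2 ≤ a ∧ a ≤ n - 1 → 2 ≤ b ∧ b ≤ n - 1 → 2 ≤ c ∧ c ≤ n - 1 →
      2 ≤ d ∧ d ≤ n - 1 → a + b = c + d → Y a * Y b = Y c * Y d := fun h1 h2 h3 h4 hs =>
    mul_eq_mul_of_slide (fun i j h1 h2 h3 => h.minorA i j (by omega) h2 (by omega) (by omega)
      (by omega) (by omega) (by omega)) h1 h2 h3 h4 hs
  have slideHigh : ∀ {a b c d : ℕ}, n + 1 ≤ a ∧ a ≤ e → n + 1 ≤ b ∧ b ≤ e → n + 1 ≤ c ∧ c ≤ e →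
      n + 1 ≤ d ∧ d ≤ e → a + b = c + d → Y a * Y b = Y c * Y d := fun h1 h2 h3 h4 hs =>
    mul_eq_mul_of_slide (fun i j h1 h2 h3 => h.minorA i j (by omega) h2 (by omega) (by omega)
      (by omega) (by omega) (by omega)) h1 h2 h3 h4 hs
  have slideMixed : ∀ {a b c d : ℕ}, 2 ≤ a ∧ a ≤ n - 1 → n + 1 ≤ b ∧ b ≤ e → 2 ≤ c ∧ c ≤ n - 1 →
      n + 1 ≤ d ∧ d ≤ e → a + b = c + d → Y a * Y b = Y c * Y d := fun h1 h2 h3 h4 hs =>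
    mul_eq_mul_of_slide_of_slide (fun i j h1 h2 h3 h4 => h.minorA i j (by omega) (by omega)
      (by omega) (by omega) (by omega) (by omega) (by omega)) h1 h2 h3 h4 hs
  have mixed : ∀ a b : ℕ, 2 ≤ a → a ≤ n - 1 → n + 1 ≤ b → b ≤ e →
      Y a * Y b = pairNF e n Y (a + b) := by
    intro a b h1 h2 h3 h4
    unfold pairNF
    rw [if_neg (by omega)]
    split_ifs with h5 h6 h7 h8
    · have := h.minorB hn (a + b - 2) (by omega) (by omega) (by omega) (by omega)
      rw [show a + b - 2 + 2 = a + b by omega] at this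
      rw [this]
      exact slideMixed (by omega) (by omega) (by omega) (by omega) (by omega)
    · simp only [aperyMon, one_ne_zero, if_true, if_false]
      rw [if_neg (by omega)]
      exact slideMixed (by omega) (by omega) (by omega) (by omega) (by omega)
    · omega
    · omega
    · rw [mul_comm (Y e)]
      exact slideMixed (by omega) (by omega) (by omega) (by omega) (by omega)
  by_cases hb' : b < n
  · -- both factors are low
    by_cases hs : a + b < n + 2
    · unfold pairNF
      split_ifs with h1 h2 h3
      · simp only [aperyMon]
        rw [if_neg (by omega), if_neg (by omega), if_pos trivial, if_neg (by omega)]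
        exact slideLow (by omega) (by omega) (by omega) (by omega) (by omega)
      · have := h.minorB hn (a + b - 2) (by omega) (by omega) (by omega) (by omega)
        rw [show a + b - 2 + 2 = a + b by omega] at this
        rw [this]
        exact slideLow (by omega) (by omega) (by omega) (by omega) (by omega)
      all_goals omega
    by_cases hs' : a + b = n + 2
    · unfold pairNF
      rw [if_neg (by omega), if_pos (by omega), hs', ← h.three (by omega)]
      exact slideLow (by omega) (by omega) (by omega) (by omega) (by omega)
    · have h2 := h.low (a + b - (n - 1)) (by omega) (by omega)
      rw [slideLow (c := n - 1) (d := a + b - (n - 1)) (by omega) (by omega) (by omega) (by omega)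
        (by omega), h2, mul_comm, mixed _ _ (by omega) (by omega) (by omega) (by omega)]
      congr 1
      omega
  by_cases ha' : a < n
  · exact mixed a b ha (by omega) (by omega) (by omega)
  -- both factors are high
  by_cases hs : a + b < e + n
  · have h2 := h.high hn (a + b - (n + 1)) (by omega) (by omega)
    rw [slideHigh (c := n + 1) (d := a + b - (n + 1)) (by omega) (by omega) (by omega) (by omega)
      (by omega), h2, mixed _ _ (by omega) (by omega) (by omega) (by omega)]
    congr 1
    omega
  unfold pairNF
  rw [if_neg (by omega), if_neg (by omega), if_neg (by omega)]
  split_ifs with h1 h2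
  · simp only [aperyMon]
    rw [if_neg (by omega), if_neg (by omega), if_pos trivial, if_pos (by omega)]
    exact slideHigh (by omega) (by omega) (by omega) (by omega) (by omega)
  · simp only [aperyMon]
    rw [if_neg (by omega), if_neg (by omega), if_pos trivial, if_neg (by omega), ← mul_assoc,
      h.cubic (by omega)]
    exact slideHigh (by omega) (by omega) (by omega) (by omega) (by omega)
  · exact slideHigh (by omega) (by omega) (by omega) (by omega) (by omega)

theorem Rels.mul_eq_pairNF (h : Rels e n Y) (he : 10 ≤ e) (hn : 2 ≤ n) (hne : n + 2 ≤ e)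
    {a b : ℕ} (ha : 2 ≤ a) (hae : a < e) (han : a ≠ n) (hb : 2 ≤ b) (hbe : b < e) (hbn : b ≠ n) :
    Y a * Y b = pairNF e n Y (a + b) := by
  wlog hab : a ≤ b generalizing a b
  · rw [mul_comm, add_comm]
    exact this hb hbe hbn ha hae han (by omega)
  rcases hn.eq_or_lt with rfl | hn
  · exact h.mul_eq_pairNF_two he (by omega) hab hbe
  · exact h.mul_eq_pairNF_of_three_le he hn hne ha hab hbe han hbn

/-- Unless the index sum `s` is congruent to `1` or `n` modulo `e`, the normal form of a product of
two variables is a power of `x_0` times a variable. -/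
theorem Rels.pairNF_eq_pow_mul (h : Rels e n Y) {s : ℕ} (h2 : 2 ≤ s) (hs : s < 2 * e)
    (h1 : s ≠ e + 1) (hn : s ≠ n) (hen : s ≠ e + n) :
    ∃ k i, i < e ∧ i ≠ 1 ∧ i ≠ n ∧ 2 * e + s = e * k + (e + i) ∧
      pairNF e n Y s = Y 0 ^ k * Y i := by
  unfold pairNF
  rw [if_neg hn, if_neg h1, if_neg hen]
  by_cases hse : s < e
  · exact ⟨1, s, hse, by omega, hn, by omega, by rw [if_pos hse.le, pow_one]⟩
  by_cases hse' : s = e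
  · subst hse'
    exact ⟨2, 0, by omega, by omega, by omega, by omega, by rw [if_pos le_rfl, h.top]; ring⟩
  · exact ⟨2, s - e, by omega, by omega, by omega, by omega, by rw [if_neg (by omega), h.top]⟩

theorem Rels.isNF_pairNF (h : Rels e n Y) (hn2 : 2 ≤ n) (hne : n + 2 ≤ e) {s : ℕ} (h2 : 4 ≤ s)
    (hs : s < 2 * e) : IsNF e n Y (2 * e + s) (pairNF e n Y s) := by
  by_cases hsn : s = n
  · refine ⟨0, n, by omega, ?_, by rw [pairNF, if_pos hsn]; ring⟩
    rw [aperyQuot, if_neg (by omega), if_neg (by omega), if_pos rfl, if_neg (by omega)]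
    omega
  by_cases hs1 : s = e + 1
  · refine ⟨0, 1, by omega, ?_, ?_⟩
    · simp only [aperyQuot, one_ne_zero, if_true, if_false]
      omega
    · rw [pairNF, if_neg hsn, if_neg (by omega), if_pos hs1]; ring
  by_cases hsen : s = e + n
  · have hv : pairNF e n Y s = if n ≤ 3 then aperyMon e n Y n else Y 0 * aperyMon e n Y n := by
      rw [pairNF, if_neg hsn, if_neg (by omega), if_neg (by omega), if_pos hsen]
    rw [hv]
    split_ifs with hn3
    · refine ⟨0, n, by omega, ?_, by ring⟩
      rw [aperyQuot, if_neg (by omega), if_neg (by omega), if_pos rfl, if_pos hn3]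
      omega
    · refine ⟨1, n, by omega, ?_, by ring⟩
      rw [aperyQuot, if_neg (by omega), if_neg (by omega), if_pos rfl, if_neg hn3]
      omega
  · obtain ⟨k, i, hi, hi1, hin, hd, hv⟩ := h.pairNF_eq_pow_mul (by omega) hs hs1 hsn hsen
    rw [hd, hv]
    exact (isNF_var Y hi hi1 hin).pow_mul k

theorem Rels.isNF_mul (h : Rels e n Y) (he : 10 ≤ e) (hn : 2 ≤ n) (hne : n + 2 ≤ e)
    {a b : ℕ} (hae : a < e) (ha1 : a ≠ 1) (han : a ≠ n) (hbe : b < e) (hb1 : b ≠ 1) (hbn : b ≠ n) :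
    IsNF e n Y (2 * e + (a + b)) (Y a * Y b) := by
  rcases Nat.eq_zero_or_pos a with rfl | ha
  · have := (isNF_var Y hbe hb1 hbn).pow_mul 1
    rwa [pow_one, show e * 1 + (e + b) = 2 * e + (0 + b) by ring] at this
  rcases Nat.eq_zero_or_pos b with rfl | hb
  · have := (isNF_var Y hae ha1 han).pow_mul 1
    rwa [pow_one, show e * 1 + (e + a) = 2 * e + (a + 0) by ring, mul_comm (Y 0)] at this
  rw [h.mul_eq_pairNF he hn hne (by omega) hae han (by omega) hbe hbn]
  exact h.isNF_pairNF hn hne (by omega) (by omega)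

/-- A product of three variables has a normal form if the product of the first two reduces to a power
of `x_0` times a variable. -/
theorem Rels.isNF_mul_mul (h : Rels e n Y) (he : 10 ≤ e) (hn : 2 ≤ n) (hne : n + 2 ≤ e)
    {a b c : ℕ} (ha : 2 ≤ a) (hae : a < e) (han : a ≠ n) (hb : 2 ≤ b) (hbe : b < e) (hbn : b ≠ n)
    (hce : c < e) (hc1 : c ≠ 1) (hcn : c ≠ n)
    (h1 : a + b ≠ e + 1) (hsn : a + b ≠ n) (hen : a + b ≠ e + n) :
    IsNF e n Y (3 * e + (a + b + c)) (Y a * (Y b * Y c)) := by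
  rw [← mul_assoc, h.mul_eq_pairNF he hn hne ha hae han hb hbe hbn]
  obtain ⟨k, i, hi, hi1, hin, hd, hv⟩ := h.pairNF_eq_pow_mul (by omega) (by omega) h1 hsn hen
  have := (h.isNF_mul he hn hne hi hi1 hin hce hc1 hcn).pow_mul k
  rw [hv, mul_assoc]
  convert this using 1
  omega

theorem Rels.isNF_mul_aperyMon_one (h : Rels e n Y) (he : 10 ≤ e) (hn : 2 ≤ n) (hne : n + 2 ≤ e)
    {j : ℕ} (hj : 2 ≤ j) (hje : j < e) (hjn : j ≠ n) :
    IsNF e n Y (4 * e + (j + 1)) (Y j * aperyMon e n Y 1) := by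
  -- A factorization of the normal form such that the product of `x_j` with its first factor is
  -- again a power of `x_0` times a variable; at most five choices of that factor are bad.
  obtain ⟨a, ha, hbad⟩ := Finset.exists_mem_notMem_of_card_lt_card
    (s := {n, e + 1 - n, n - j, e + 1 - j, e + n - j}) (t := Finset.Icc 2 7)
    (lt_of_le_of_lt Finset.card_le_five (by simp))
  simp only [Finset.mem_Icc, Finset.mem_insert, Finset.mem_singleton, not_or] at ha hbad
  have hu : aperyMon e n Y 1 = Y a * Y (e + 1 - a) := by
    rw [h.mul_eq_pairNF he hn hne (by omega) (by omega) (by omega) (by omega) (by omega) (by omega),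
      pairNF, if_neg (by omega), if_neg (by omega), if_pos (by omega)]
  rw [hu]
  have := h.isNF_mul_mul he hn hne hj hje hjn (b := a) (c := e + 1 - a) (by omega) (by omega)
    (by omega) (by omega) (by omega) (by omega) (by omega) (by omega) (by omega)
  convert this using 1
  omega

/-- As `isNF_mul_mul`, but the product of the first two factors may also lie in the class of `1`. -/
theorem Rels.isNF_mul_mul' (h : Rels e n Y) (he : 10 ≤ e) (hn : 2 ≤ n) (hne : n + 2 ≤ e)
    {a b c : ℕ} (ha : 2 ≤ a) (hae : a < e) (han : a ≠ n) (hb : 2 ≤ b) (hbe : b < e) (hbn : b ≠ n)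
    (hc : 2 ≤ c) (hce : c < e) (hcn : c ≠ n) (hsn : a + b ≠ n) (hen : a + b ≠ e + n) :
    IsNF e n Y (3 * e + (a + b + c)) (Y a * (Y b * Y c)) := by
  by_cases h1 : a + b = e + 1
  · rw [← mul_assoc, h.mul_eq_pairNF he hn hne ha hae han hb hbe hbn, pairNF, if_neg hsn,
      if_neg (by omega), if_pos h1, mul_comm _ (Y c)]
    convert h.isNF_mul_aperyMon_one he hn hne hc hce hcn using 1
    omega
  · exact h.isNF_mul_mul he hn hne ha hae han hb hbe hbn hce (by omega) hcn h1 hsn hen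

theorem Rels.isNF_mul_aperyMon_n (h : Rels e n Y) (he : 10 ≤ e) (hn : 2 ≤ n) (hne : n + 2 ≤ e)
    {j : ℕ} (hj : 2 ≤ j) (hje : j < e) (hjn : j ≠ n) :
    IsNF e n Y (e * (1 + aperyQuot n n) + (j + n)) (Y j * aperyMon e n Y n) := by
  by_cases hn3 : n ≤ 3
  · rw [aperyQuot, aperyMon, if_neg (by omega), if_neg (by omega), if_pos rfl, if_pos hn3,
      if_neg (by omega), if_neg (by omega), if_pos rfl, if_pos hn3]
    by_cases hjn1 : j = n + 1
    · convert h.isNF_mul_mul' he hn hne hj hje hjn (b := n + 1) (c := e - 1) (by omega) (by omega)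
        (by omega) (by omega) (by omega) (by omega) (by omega) (by omega) using 1
      omega
    · rw [mul_comm (Y (n + 1))]
      convert h.isNF_mul_mul' he hn hne hj hje hjn (b := e - 1) (c := n + 1) (by omega) (by omega)
        (by omega) (by omega) (by omega) (by omega) (by omega) (by omega) using 1
      omega
  rw [aperyQuot, aperyMon, if_neg (by omega), if_neg (by omega), if_pos rfl, if_neg hn3,
    if_neg (by omega), if_neg (by omega), if_pos rfl, if_neg hn3]
  by_cases hj2 : j + 2 = n
  · by_cases hn4 : n = 4
    · -- the only relation that reaches `x_2 ^ 3`
      subst hn4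
      obtain rfl : j = 2 := by omega
      rw [show Y 2 * (Y 2 * Y (4 - 2)) = Y 2 ^ 3 by ring, h.cube rfl]
      convert h.isNF_mul he hn hne (a := 7) (b := e - 1) (by omega) (by omega) (by omega) (by omega)
        (by omega) (by omega) using 1
      omega
    · rw [mul_comm (Y 2)]
      convert h.isNF_mul_mul' he hn hne hj hje hjn (b := n - 2) (c := 2) (by omega) (by omega)
        (by omega) (by omega) (by omega) (by omega) (by omega) (by omega) using 1
      omega
  · convert h.isNF_mul_mul' he hn hne hj hje hjn (b := 2) (c := n - 2) (by omega) (by omega)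
      (by omega) (by omega) (by omega) (by omega) (by omega) (by omega) using 1
    omega

/-- The normal forms are closed under multiplication by variables. -/
theorem Rels.isNF_var_mul (h : Rels e n Y) (he : 10 ≤ e) (hn : 2 ≤ n) (hne : n + 2 ≤ e)
    {j : ℕ} (hje : j < e) (hj1 : j ≠ 1) (hjn : j ≠ n) {d : ℕ} {z : Q} (hz : IsNF e n Y d z) :
    IsNF e n Y (e + j + d) (Y j * z) := by
  rcases Nat.eq_zero_or_pos j with rfl | hj
  · simpa using hz.pow_mul 1
  obtain ⟨k, r, hr, rfl, rfl⟩ := hz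
  suffices hs : IsNF e n Y (e * (1 + aperyQuot n r) + (j + r)) (Y j * aperyMon e n Y r) by
    rw [show e + j + (e * (k + aperyQuot n r) + r) =
      e * k + (e * (1 + aperyQuot n r) + (j + r)) by ring, mul_left_comm]
    exact hs.pow_mul k
  by_cases h0 : r = 0
  · subst h0
    simpa [aperyQuot, aperyMon] using isNF_var Y hje hj1 hjn
  by_cases h1 : r = 1
  · subst h1
    convert h.isNF_mul_aperyMon_one he hn hne (by omega) hje hjn using 1
    simp only [aperyQuot, one_ne_zero, if_true, if_false]
    omega
  by_cases h2 : r = n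
  · subst h2
    exact h.isNF_mul_aperyMon_n he hn hne (by omega) hje hjn
  · rw [aperyQuot, aperyMon, if_neg h0, if_neg h1, if_neg h2, if_neg h0, if_neg h1, if_neg h2]
    convert h.isNF_mul he hn hne hje hj1 hjn hr h1 h2 using 1
    omega

end Products

/-! ### The list of generators as a list of binomials -/

section Generators

/-- The binomials in `J_n ∪ K_n ∪ L_{e,n}`: `Fam e n a b t s` says that one of them is, up to sign,
the difference of the leading monomial `lead a b` and the monomial `t`; the sign is positive if `s`
is `true`. Monomials are multisets of indices. The leading monomial is `x_a x_b` (where `a ≤ b`),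
except that the pair `(0, 0)` is the label of the leading monomial `x_2 ^ 3`. -/
inductive Fam (e n : ℕ) : ℕ → ℕ → Multiset ℕ → Bool → Prop
  | minorB (b) : 3 ≤ n → 4 ≤ b → b < e → b ≠ n → b ≠ n + 2 → Fam e n 0 b {2, b - 2} true
  | minorB_two (b) : n = 2 → 6 ≤ b → b < e → Fam e n 0 b {3, b - 3} true
  | minorB_last (c) : (c = 2 ∧ 3 ≤ n ∧ n ≠ e - 2) ∨ (c = 3 ∧ (n = 2 ∨ n = e - 2)) →
      Fam e n c (e - c) {0, 0, 0} false
  | minorA (a b) : 3 ≤ a → a ≤ b → b + 2 ≤ e → a ≠ n → a ≠ n + 1 → b ≠ n - 1 → b ≠ n →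
      Fam e n a b {a - 1, b + 1} false
  | minorA_last (a) : 3 ≤ a → a < e → a ≠ n → a ≠ n + 1 → Fam e n a (e - 1) {0, 0, a - 1} false
  | high (b) : 3 ≤ n → n + 1 ≤ b → b + 3 ≤ e → Fam e n (n + 1) b {n - 1, b + 2} true
  | high_last : 3 ≤ n → n + 3 ≤ e → Fam e n (n + 1) (e - 2) {0, 0, n - 1} false
  | cubic : 4 ≤ n → Fam e n (n + 1) (e - 1) {0, 2, n - 2} false
  | low (a) : 4 ≤ a → a < n → Fam e n a (n - 1) {a - 2, n + 1} true
  | three : 4 ≤ n → n + 3 ≤ e → Fam e n 0 (n + 2) {3, n - 1} false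
  | cube : n = 4 → Fam e n 0 0 {7, e - 1} true

/-- The leading monomial with label `(a, b)`. -/
def lead (a b : ℕ) : Multiset ℕ := if b = 0 then {2, 2, 2} else {a, b}

/-- The weight of the label `(a, b)`; the tail of a binomial is never the leading monomial of a
binomial of the same or a larger weight. -/
def weight (e a b : ℕ) : ℕ := if b = 0 then e + 1 else if a = 0 then e else a

variable {e n : ℕ}

theorem pair_eq_pair {a b c d : ℕ} (hab : a ≤ b) (hcd : c ≤ d)
    (h : ({a, b} : Multiset ℕ) = {c, d}) : a = c ∧ b = d := by
  have h1 : a ∈ ({c, d} : Multiset ℕ) := h ▸ by simp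
  have h2 : c ∈ ({a, b} : Multiset ℕ) := h ▸ by simp
  have h3 := congrArg Multiset.sum h
  simp at h1 h2 h3
  omega

theorem lead_eq_pair {a b c d : ℕ} (hab : a ≤ b) (hcd : c ≤ d) (h : lead a b = {c, d}) :
    b ≠ 0 ∧ a = c ∧ b = d := by
  unfold lead at h
  split_ifs at h with hb
  · simpa using congrArg Multiset.card h
  · exact ⟨hb, pair_eq_pair hab hcd h⟩

theorem lead_ne_triple {a b c d : ℕ} : lead a b ≠ {0, c, d} := by
  unfold lead
  intro h
  split_ifs at h
  · have : (0 : ℕ) ∈ ({2, 2, 2} : Multiset ℕ) := h ▸ by simp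
    simp at this
  · simpa using congrArg Multiset.card h

theorem lead_injective {a b c d : ℕ} (hab : a ≤ b) (hcd : c ≤ d) (h : lead a b = lead c d) :
    a = c ∧ b = d := by
  by_cases hd : d = 0
  · subst hd
    by_cases hb : b = 0
    · omega
    · simpa [lead, hb] using congrArg Multiset.card h
  · rw [lead.eq_def c d, if_neg hd] at h
    exact (lead_eq_pair hab hcd h).2

theorem Fam.le {a b : ℕ} {t : Multiset ℕ} {s : Bool} (he : 10 ≤ e) (hne : n + 2 ≤ e)
    (h : Fam e n a b t s) : a ≤ b := by
  cases h <;> omega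

/-- Different generators have different labels, hence different leading monomials. -/
theorem Fam.unique {a b : ℕ} {t t' : Multiset ℕ} {s s' : Bool} (he : 10 ≤ e) (hne : n + 2 ≤ e)
    (h : Fam e n a b t s) (h' : Fam e n a b t' s') : t = t' ∧ s = s' := by
  obtain ⟨a', ha⟩ : ∃ a', a' = a := ⟨_, rfl⟩
  obtain ⟨b', hb⟩ : ∃ b', b' = b := ⟨_, rfl⟩
  rw [← ha, ← hb] at h'
  cases h <;> cases h' <;> first | omega | (subst_vars; exact ⟨rfl, rfl⟩)

/-- The coefficients of the generators at the leading monomials form a triangular matrix. -/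
theorem Fam.weight_lt {a b a' b' : ℕ} {t t' : Multiset ℕ} {s s' : Bool} (he : 10 ≤ e)
    (hn : 2 ≤ n) (hne : n + 2 ≤ e) (h : Fam e n a b t s) (h' : Fam e n a' b' t' s')
    (heq : lead a b = t') : weight e a b < weight e a' b' := by
  have hab := h.le he hne
  cases h' <;> first
    | exact absurd heq lead_ne_triple
    | (obtain ⟨h1, h2, h3⟩ := lead_eq_pair hab (by omega) heq
       unfold weight
       split_ifs <;> omega)

/-- All variables occurring in the generators exist. -/
theorem Fam.valid {a b : ℕ} {t : Multiset ℕ} {s : Bool} (he : 10 ≤ e)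
    (hn : 2 ≤ n) (hne : n + 2 ≤ e) (h : Fam e n a b t s) :
    (∀ i ∈ lead a b, i < e ∧ i ≠ 1 ∧ i ≠ n) ∧ ∀ i ∈ t, i < e ∧ i ≠ 1 ∧ i ≠ n := by
  unfold lead
  cases h <;> split_ifs <;>
    simp only [Multiset.insert_eq_cons, Multiset.mem_cons, Multiset.mem_singleton,
      forall_eq_or_imp, forall_eq] <;> omega

theorem Fam.degree_eq {a b : ℕ} {t : Multiset ℕ} {s : Bool} (he : 10 ≤ e)
    (hn : 2 ≤ n) (hne : n + 2 ≤ e) (h : Fam e n a b t s) :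
    e * (lead a b).card + (lead a b).sum = e * t.card + t.sum := by
  unfold lead
  cases h <;> split_ifs <;> simp <;> first | contradiction | omega

theorem Fam.two_le_card {a b : ℕ} {t : Multiset ℕ} {s : Bool} (h : Fam e n a b t s) :
    2 ≤ (lead a b).card ∧ 2 ≤ t.card := by
  unfold lead
  cases h <;> split_ifs <;> simp

/-- No proper divisor of a leading monomial occurs in a generator: such a divisor is `1`, a variable
or, below the leading monomial `x_2 ^ 3` for `n = 4`, the monomial `x_2 ^ 2`. -/
theorem Fam.not_lt_lead {a b a' b' : ℕ} {t t' : Multiset ℕ} {s s' : Bool} (he : 10 ≤ e)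
    (hn : 2 ≤ n) (hne : n + 2 ≤ e) (h : Fam e n a b t s) (h' : Fam e n a' b' t' s') :
    ¬ lead a' b' < lead a b ∧ ¬ t' < lead a b := by
  have hcard := h'.two_le_card
  by_cases hb : b = 0
  · have h4 : n = 4 := by cases h <;> omega
    have h2 : lead a b = Multiset.replicate 3 2 := by rw [lead, if_pos hb]; rfl
    have key : ∀ {u : Multiset ℕ}, u < lead a b → 2 ≤ u.card → u = {2, 2} := by
      intro u hu hc
      have h3 := Multiset.card_lt_card hu
      rw [h2] at hu h3
      rw [Multiset.card_replicate] at h3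
      obtain ⟨m, _, rfl⟩ := Multiset.le_replicate_iff.1 hu.le
      rw [Multiset.card_replicate] at hc h3
      obtain rfl : m = 2 := by omega
      rfl
    constructor
    · intro hlt
      have := lead_eq_pair (h'.le he hne) le_rfl (key hlt hcard.1)
      cases h' <;> omega
    · intro hlt
      have h5 := key hlt hcard.2
      have h6 := congrArg Multiset.sum h5
      have h7 := congrArg Multiset.card h5
      cases h' <;> simp at h6 h7 <;> omega
  · have h2 : (lead a b).card = 2 := by rw [lead, if_neg hb]; rfl
    constructor <;> intro hlt <;> have := Multiset.card_lt_card hlt <;> omega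

end Generators

/-! ### Generators and relations in the polynomial ring -/

noncomputable section

variable (K : Type*) [Field K] (e n : ℕ)

/-- The monomial of `R(e,1,n)` whose factors have the indices in `s`. -/
def mon (s : Multiset ℕ) : R K e 1 n := (s.map (x K e 1 n)).prod

/-- The generator with the label `(a, b)`, the tail `t` and the sign `s`; see `Fam`. -/
def binomial (a b : ℕ) (t : Multiset ℕ) (s : Bool) : R K e 1 n :=
  if s then mon K e n (lead a b) - mon K e n t else mon K e n t - mon K e n (lead a b)

variable {K e n}

theorem mem_J_iff {f : R K e 1 n} : f ∈ J K e n ↔ ∃ c d : ACol e n, c < d ∧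
    f = A K e n 0 c * A K e n 1 d - A K e n 0 d * A K e n 1 c := by
  simp [J, Matrix.det_fin_two]

theorem mem_Kset_iff {f : R K e 1 n} : f ∈ Kset K e n ↔ ∃ d : BCol e n, BCol.first e n < d ∧
    f = B K e n 0 (BCol.first e n) * B K e n 1 d - B K e n 0 d * B K e n 1 (BCol.first e n) := by
  simp [Kset, Matrix.det_fin_two]

theorem B_top (d : BCol e n) : B K e n 0 d = x K e 1 n d.1 := rfl

theorem B_two_bot (hn : n = 2) (d : BCol e n) : B K e n 1 d =
    if d.1 = e - 3 then x K e 1 n 0 ^ 2 else x K e 1 n (d.1 + 3) := by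
  simp only [B, one_ne_zero, if_false]
  rw [if_pos hn]

theorem B_bot (hn : n ≠ 2) (d : BCol e n) : B K e n 1 d =
    if d.1 = e - 2 then x K e 1 n 0 ^ 2 else x K e 1 n (d.1 + 2) := by
  simp only [B, one_ne_zero, if_false]
  rw [if_neg hn]

theorem B_two_bot_first (he : 10 ≤ e) (hn : n = 2) :
    B K e n 1 (BCol.first e n) = x K e 1 n 3 := by
  rw [B_two_bot hn]
  exact if_neg (by simp only [BCol.first]; omega)

theorem B_bot_first (he : 10 ≤ e) (hn : n ≠ 2) : B K e n 1 (BCol.first e n) = x K e 1 n 2 := by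
  rw [B_bot hn]
  exact if_neg (by simp only [BCol.first]; omega)

theorem exists_fam_of_mem_J (he : 10 ≤ e) (hn : 2 ≤ n) (hne : n + 2 ≤ e) {f : R K e 1 n}
    (hf : f ∈ J K e n) : ∃ a b t s, Fam e n a b t s ∧ f = binomial K e n a b t s := by
  obtain ⟨⟨c, hc⟩, ⟨d, hd⟩, hcd, rfl⟩ := mem_J_iff.1 hf
  replace hcd : c < d := hcd
  simp only [A, if_true, one_ne_zero, if_false]
  rw [if_neg (by omega : c ≠ e - 1)]
  by_cases hde : d = e - 1
  · subst hde
    refine ⟨_, _, _, _, Fam.minorA_last (c + 1) (by omega) (by omega) (by omega) (by omega), ?_⟩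
    simp [binomial, mon, lead, show e - 1 ≠ 0 by omega]
    ring
  · rw [if_neg hde]
    refine ⟨_, _, _, _, Fam.minorA (c + 1) d (by omega) (by omega) (by omega) (by omega) (by omega)
      (by omega) (by omega), ?_⟩
    simp [binomial, mon, lead, show d ≠ 0 by omega]
    ring

theorem exists_fam_of_mem_Kset (he : 10 ≤ e) (hn : 2 ≤ n) (hne : n + 2 ≤ e) {f : R K e 1 n}
    (hf : f ∈ Kset K e n) : ∃ a b t s, Fam e n a b t s ∧ f = binomial K e n a b t s := by
  obtain ⟨⟨d, hd⟩, hcd, rfl⟩ := mem_Kset_iff.1 hf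
  replace hcd : 0 < d := hcd
  rw [B_top, B_top]
  by_cases hn2 : n = 2
  · rw [B_two_bot_first he hn2, B_two_bot hn2]
    simp only [BCol.first]
    by_cases hde : d = e - 3
    · subst hde
      refine ⟨_, _, _, _, Fam.minorB_last 3 (by omega), ?_⟩
      simp [binomial, mon, lead, show e - 3 ≠ 0 by omega]
      ring
    · rw [if_neg hde]
      refine ⟨_, _, _, _, Fam.minorB_two (d + 3) (by omega) (by omega) (by omega), ?_⟩
      simp [binomial, mon, lead]
      ring
  · rw [B_bot_first he hn2, B_bot hn2]
    simp only [BCol.first]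
    by_cases hde : d = e - 2
    · subst hde
      refine ⟨_, _, _, _, Fam.minorB_last 2 (by omega), ?_⟩
      simp [binomial, mon, lead, show e - 2 ≠ 0 by omega]
      ring
    · rw [if_neg hde]
      refine ⟨_, _, _, _, Fam.minorB (d + 2) (by omega) (by omega) (by omega) (by omega) (by omega),
        ?_⟩
      simp [binomial, mon, lead]
      ring

theorem exists_fam_of_mem_L (he : 10 ≤ e) (hn : 2 ≤ n) (hne : n + 2 ≤ e) {f : R K e 1 n}
    (hf : f ∈ L K e n) : ∃ a b t s, Fam e n a b t s ∧ f = binomial K e n a b t s := by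
  have high : ∀ b, 3 ≤ n → n + 1 ≤ b → b + 3 ≤ e →
      f = x K e 1 n (n + 1) * x K e 1 n b - x K e 1 n (n - 1) * x K e 1 n (b + 2) →
      ∃ a b t s, Fam e n a b t s ∧ f = binomial K e n a b t s := by
    rintro b h1 h2 h3 rfl
    refine ⟨_, _, _, _, Fam.high b h1 h2 h3, ?_⟩
    simp [binomial, mon, lead, show b ≠ 0 by omega]
  have high_last : 3 ≤ n → n + 3 ≤ e →
      f = x K e 1 n 0 ^ 2 * x K e 1 n (n - 1) - x K e 1 n (n + 1) * x K e 1 n (e - 2) →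
      ∃ a b t s, Fam e n a b t s ∧ f = binomial K e n a b t s := by
    rintro h1 h2 rfl
    refine ⟨_, _, _, _, Fam.high_last h1 h2, ?_⟩
    simp [binomial, mon, lead, show e - 2 ≠ 0 by omega]
    ring
  have cubic : 4 ≤ n →
      f = x K e 1 n 0 * x K e 1 n 2 * x K e 1 n (n - 2) - x K e 1 n (n + 1) * x K e 1 n (e - 1) →
      ∃ a b t s, Fam e n a b t s ∧ f = binomial K e n a b t s := by
    rintro h1 rfl
    refine ⟨_, _, _, _, Fam.cubic h1, ?_⟩
    simp [binomial, mon, lead, show e - 1 ≠ 0 by omega]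
    ring
  have low : ∀ a, 4 ≤ a → a < n →
      f = x K e 1 n (n - 1) * x K e 1 n a - x K e 1 n (n + 1) * x K e 1 n (a - 2) →
      ∃ a b t s, Fam e n a b t s ∧ f = binomial K e n a b t s := by
    rintro a h1 h2 rfl
    refine ⟨_, _, _, _, Fam.low a h1 h2, ?_⟩
    simp [binomial, mon, lead, show n - 1 ≠ 0 by omega]
    ring
  have three : 4 ≤ n → n + 3 ≤ e →
      f = x K e 1 n 3 * x K e 1 n (n - 1) - x K e 1 n 0 * x K e 1 n (n + 2) →
      ∃ a b t s, Fam e n a b t s ∧ f = binomial K e n a b t s := by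
    rintro h1 h2 rfl
    refine ⟨_, _, _, _, Fam.three h1 h2, ?_⟩
    simp [binomial, mon, lead]
  unfold L at hf
  dsimp only at hf
  split_ifs at hf with h2 h3 h4 h5 h6
  · exact hf.elim
  · subst h3
    rcases hf with ⟨i, hi, rfl⟩ | rfl
    · refine high (4 + i) (by omega) (by omega) (by omega) ?_
      rw [show 4 + i + 2 = 6 + i by omega]
    · exact high_last (by omega) (by omega) rfl
  · subst h4
    rcases hf with (⟨i, hi, rfl⟩ | rfl) | rfl | rfl | rfl
    · refine high (5 + i) (by omega) (by omega) (by omega) ?_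
      rw [show 5 + i + 2 = 7 + i by omega]
    · exact three (by omega) (by omega) (by ring)
    · exact high_last (by omega) (by omega) rfl
    · exact cubic (by omega) (by ring)
    · refine ⟨_, _, _, _, Fam.cube rfl, ?_⟩
      simp [binomial, mon, lead]
      ring
  · rcases hf with ((⟨i, hi, rfl⟩ | ⟨i, hi, rfl⟩) | rfl) | rfl | rfl
    · refine high (n + 1 + i) (by omega) (by omega) (by omega) ?_
      rw [show n + 1 + i + 2 = n + 3 + i by omega]
    · refine low (n - 1 - i) (by omega) (by omega) ?_
      rw [show n - 1 - i - 2 = n - 3 - i by omega]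
    · exact three (by omega) (by omega) (by ring)
    · exact high_last (by omega) (by omega) rfl
    · exact cubic (by omega) rfl
  · obtain rfl : e = n + 3 := by omega
    rcases hf with (⟨i, hi, rfl⟩ | rfl) | rfl | rfl
    · refine low (n - 1 - i) (by omega) (by omega) ?_
      rw [show n + 3 - 4 = n - 1 by omega, show n + 3 - 2 = n + 1 by omega,
        show n - 1 - i - 2 = n + 3 - 6 - i by omega]
    · refine three (by omega) (by omega) ?_
      rw [show n + 3 - 4 = n - 1 by omega, show n + 3 - 1 = n + 2 by omega]
      ring
    · refine high_last (by omega) (by omega) ?_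
      rw [show n + 3 - 4 = n - 1 by omega, show n + 3 - 2 = n + 1 by omega]
      ring
    · refine cubic (by omega) ?_
      rw [show n + 3 - 5 = n - 2 by omega, show n + 3 - 2 = n + 1 by omega]
  · obtain rfl : e = n + 2 := by omega
    rcases hf with ⟨i, hi, rfl⟩ | rfl | rfl
    · refine low (n - 1 - i) (by omega) (by omega) ?_
      rw [show n + 2 - 3 = n - 1 by omega, show n + 2 - 1 = n + 1 by omega,
        show n - 1 - i - 2 = n + 2 - 5 - i by omega]
    · refine ⟨_, _, _, _, Fam.minorB_last 3 (by omega), ?_⟩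
      simp [binomial, mon, lead, show n - 1 ≠ 0 by omega]
      ring
    · refine cubic (by omega) ?_
      rw [show n + 2 - 4 = n - 2 by omega, show n + 2 - 1 = n + 1 by omega]
      ring

theorem exists_fam_of_mem (he : 10 ≤ e) (hn : 2 ≤ n) (hne : n + 2 ≤ e) {f : R K e 1 n}
    (hf : f ∈ J K e n ∪ Kset K e n ∪ L K e n) :
    ∃ a b t s, Fam e n a b t s ∧ f = binomial K e n a b t s := by
  rcases hf with (hf | hf) | hf
  · exact exists_fam_of_mem_J he hn hne hf
  · exact exists_fam_of_mem_Kset he hn hne hf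
  · exact exists_fam_of_mem_L he hn hne hf

theorem mem_L_high (he : 10 ≤ e) (hn : 3 ≤ n) {b : ℕ} (h1 : n + 1 ≤ b) (h2 : b + 3 ≤ e) :
    x K e 1 n (n + 1) * x K e 1 n b - x K e 1 n (n - 1) * x K e 1 n (b + 2) ∈ L K e n := by
  unfold L
  dsimp only
  obtain ⟨i, rfl⟩ := Nat.exists_eq_add_of_le h1
  split_ifs with h2 h3 h4 h5 h6
  · omega
  · subst h3
    exact Or.inl ⟨i, by omega, by rw [show 3 + 1 + i + 2 = 6 + i by omega]⟩
  · subst h4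
    exact Or.inl (Or.inl ⟨i, by omega, by rw [show 4 + 1 + i + 2 = 7 + i by omega]⟩)
  · exact Or.inl (Or.inl (Or.inl ⟨i, by omega, by rw [show n + 1 + i + 2 = n + 3 + i by omega]⟩))
  · omega
  · omega

theorem mem_L_high_last (he : 10 ≤ e) (hn : 3 ≤ n) (hne : n + 3 ≤ e) :
    x K e 1 n 0 ^ 2 * x K e 1 n (n - 1) - x K e 1 n (n + 1) * x K e 1 n (e - 2) ∈ L K e n := by
  unfold L
  dsimp only
  split_ifs with h2 h3 h4 h5 h6
  · omega
  · subst h3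
    exact Or.inr rfl
  · subst h4
    exact Or.inr (Or.inl rfl)
  · exact Or.inr (Or.inl rfl)
  · obtain rfl : e = n + 3 := by omega
    refine Or.inr (Or.inl ?_)
    rw [show n + 3 - 4 = n - 1 by omega, show n + 3 - 2 = n + 1 by omega]
    ring
  · omega

theorem mem_L_cubic (he : 10 ≤ e) (hn : 4 ≤ n) (hne : n + 2 ≤ e) :
    x K e 1 n 0 * x K e 1 n 2 * x K e 1 n (n - 2) - x K e 1 n (n + 1) * x K e 1 n (e - 1) ∈
      L K e n := by
  unfold L
  dsimp only
  split_ifs with h2 h3 h4 h5 h6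
  · omega
  · omega
  · subst h4
    exact Or.inr (Or.inr (Or.inl (by ring)))
  · exact Or.inr (Or.inr rfl)
  · obtain rfl : e = n + 3 := by omega
    refine Or.inr (Or.inr ?_)
    rw [show n + 3 - 5 = n - 2 by omega, show n + 3 - 2 = n + 1 by omega]
    rfl
  · obtain rfl : e = n + 2 := by omega
    refine Or.inr (Or.inr ?_)
    rw [show n + 2 - 4 = n - 2 by omega, show n + 2 - 1 = n + 1 by omega, ← pow_two]
    rfl

theorem mem_L_low (he : 10 ≤ e) (hne : n + 2 ≤ e) {a : ℕ} (h1 : 4 ≤ a) (h2 : a < n) :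
    x K e 1 n (n - 1) * x K e 1 n a - x K e 1 n (n + 1) * x K e 1 n (a - 2) ∈ L K e n := by
  unfold L
  dsimp only
  obtain ⟨i, rfl⟩ : ∃ i, n = a + 1 + i := Nat.exists_eq_add_of_le h2
  split_ifs with h2 h3 h4 h5 h6
  · omega
  · omega
  · omega
  · refine Or.inl (Or.inl (Or.inr ⟨i, by omega, ?_⟩))
    rw [show a + 1 + i - 1 - i = a by omega, show a + 1 + i - 3 - i = a - 2 by omega]
  · obtain rfl : e = a + 1 + i + 3 := by omega
    refine Or.inl (Or.inl ⟨i, by omega, ?_⟩)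
    rw [show a + 1 + i + 3 - 4 = a + 1 + i - 1 by omega, show a + 1 + i - 1 - i = a by omega,
      show a + 1 + i + 3 - 2 = a + 1 + i + 1 by omega,
      show a + 1 + i + 3 - 6 - i = a - 2 by omega]
  · obtain rfl : e = a + 1 + i + 2 := by omega
    refine Or.inl ⟨i, by omega, ?_⟩
    rw [show a + 1 + i + 2 - 3 = a + 1 + i - 1 by omega, show a + 1 + i - 1 - i = a by omega,
      show a + 1 + i + 2 - 1 = a + 1 + i + 1 by omega,
      show a + 1 + i + 2 - 5 - i = a - 2 by omega]

theorem mem_L_three (he : 10 ≤ e) (hn : 4 ≤ n) (hne : n + 3 ≤ e) :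
    x K e 1 n 3 * x K e 1 n (n - 1) - x K e 1 n 0 * x K e 1 n (n + 2) ∈ L K e n := by
  rw [mul_comm (x K e 1 n 3), mul_comm (x K e 1 n 0)]
  unfold L
  dsimp only
  split_ifs with h2 h3 h4 h5 h6
  · omega
  · omega
  · subst h4
    exact Or.inl (Or.inr (by rw [← pow_two, mul_comm]; rfl))
  · exact Or.inl (Or.inr rfl)
  · obtain rfl : e = n + 3 := by omega
    refine Or.inl (Or.inr ?_)
    rw [show n + 3 - 4 = n - 1 by omega, show n + 3 - 1 = n + 2 by omega,
      mul_comm _ (x K (n + 3) 1 n (n + 2))]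
    rfl
  · omega

theorem mem_L_three_last (he : 10 ≤ e) (hne : n + 2 = e) :
    x K e 1 n 0 ^ 3 - x K e 1 n 3 * x K e 1 n (n - 1) ∈ L K e n := by
  subst hne
  unfold L
  dsimp only
  split_ifs with h2 h3 h4 h5 h6
  all_goals try omega
  exact Or.inr (Or.inl rfl)

theorem mem_L_cube : x K e 1 4 2 ^ 3 - x K e 1 4 7 * x K e 1 4 (e - 1) ∈ L K e 4 := by
  unfold L
  exact Or.inr (Or.inr (Or.inr rfl))

/-- The variables of a ring receiving `R(e,1,n)`, extended by the value of `x_0 ^ 2` at `e`. -/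
def extVar {Q : Type*} [CommRing Q] (φ : R K e 1 n →+* Q) (i : ℕ) : Q :=
  if i = e then φ (x K e 1 n 0) ^ 2 else φ (x K e 1 n i)

theorem extVar_of_lt {Q : Type*} [CommRing Q] (φ : R K e 1 n →+* Q) {i : ℕ} (hi : i < e) :
    extVar φ i = φ (x K e 1 n i) := if_neg hi.ne

theorem extVar_top {Q : Type*} [CommRing Q] (φ : R K e 1 n →+* Q) :
    extVar φ e = φ (x K e 1 n 0) ^ 2 := if_pos rfl

/-- A ring homomorphism that kills the generators satisfies the relations `Rels`. -/
theorem rels_extVar (he : 10 ≤ e) (hn : 2 ≤ n) (hne : n + 2 ≤ e) {Q : Type*} [CommRing Q]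
    (φ : R K e 1 n →+* Q) (hφ : ∀ f ∈ J K e n ∪ Kset K e n ∪ L K e n, φ f = 0) :
    Rels e n (extVar φ) := by
  have hL : ∀ {f g}, f - g ∈ L K e n → φ f = φ g := fun h => by
    rw [← sub_eq_zero, ← map_sub]
    exact hφ _ (Or.inr h)
  have hK : ∀ d : BCol e n, 0 < d.1 → φ (x K e 1 n 0) * φ (B K e n 1 d) =
      φ (x K e 1 n d.1) * φ (B K e n 1 (BCol.first e n)) := by
    intro d h0
    have := hφ _ (Or.inl (Or.inr (mem_Kset_iff.2 ⟨d, h0, rfl⟩)))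
    rw [map_sub, map_mul, map_mul, sub_eq_zero] at this
    exact this
  constructor
  · rw [extVar_top, extVar_of_lt _ (by omega)]
  · intro i j h1 h2 h3 h4 h5 h6 h7
    have := hφ _ (Or.inl (Or.inl (mem_J_iff.2
      ⟨⟨i, h1, by omega, h4, h5⟩, ⟨j, by omega, by omega, h6, h7⟩, h2, rfl⟩)))
    simp only [A, if_true, one_ne_zero, if_false] at this
    rw [if_neg (by omega : i ≠ e - 1), map_sub, map_mul, map_mul, sub_eq_zero] at this
    rw [extVar_of_lt _ (by omega : i < e), extVar_of_lt _ h3, extVar_of_lt _ (by omega : i + 1 < e),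
      mul_comm (φ (x K e 1 n (i + 1))), ← this]
    by_cases hj : j = e - 1
    · rw [if_pos hj, map_pow, show j + 1 = e by omega, extVar_top]
    · rw [if_neg hj, extVar_of_lt _ (by omega)]
  · rintro rfl j h1 h2
    have := hK ⟨j, by omega⟩ (by simp only; omega)
    rw [B_two_bot_first he rfl, B_two_bot rfl] at this
    rw [extVar_of_lt _ (by omega : 0 < e), extVar_of_lt _ (by omega : 3 < e),
      extVar_of_lt _ (by omega : j < e), mul_comm (φ (x K e 1 2 3)), ← this]
    by_cases hj : j = e - 3
    · rw [if_pos hj, map_pow, show j + 3 = e by omega, extVar_top]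
    · rw [if_neg hj, extVar_of_lt _ (by omega)]
  · intro hn3 j h1 h2 h3 h4
    have := hK ⟨j, by omega⟩ (by simp only; omega)
    rw [B_bot_first he (by omega), B_bot (by omega)] at this
    rw [extVar_of_lt _ (by omega : 0 < e), extVar_of_lt _ (by omega : 2 < e),
      extVar_of_lt _ (by omega : j < e), mul_comm (φ (x K e 1 n 2)), ← this]
    by_cases hj : j = e - 2
    · rw [if_pos hj, map_pow, show j + 2 = e by omega, extVar_top]
    · rw [if_neg hj, extVar_of_lt _ (by omega)]
  · intro hn3 b h1 h2
    rw [extVar_of_lt _ (by omega : n + 1 < e), extVar_of_lt _ (by omega : b < e),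
      extVar_of_lt _ (by omega : n - 1 < e)]
    by_cases hb : b = e - 2
    · have := hL (mem_L_high_last (K := K) he hn3 (by omega))
      subst hb
      rw [show e - 2 + 2 = e by omega, extVar_top]
      simp only [map_mul, map_pow] at this
      rw [← this, mul_comm]
    · rw [extVar_of_lt _ (by omega : b + 2 < e)]
      simpa only [map_mul] using hL (mem_L_high (K := K) he hn3 h1 (by omega))
  · intro a h1 h2
    rw [extVar_of_lt _ (by omega : n + 1 < e), extVar_of_lt _ (by omega : n - 1 < e),
      extVar_of_lt _ (by omega : a < e), extVar_of_lt _ (by omega : a - 2 < e)]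
    simpa only [map_mul] using hL (mem_L_low (K := K) he hne h1 h2)
  · intro h4
    rw [extVar_of_lt _ (by omega : 3 < e), extVar_of_lt _ (by omega : n - 1 < e),
      extVar_of_lt _ (by omega : 0 < e)]
    by_cases hne' : n + 2 = e
    · have := hL (mem_L_three_last (K := K) he hne')
      simp only [map_mul, map_pow] at this
      rw [hne', extVar_top, ← this]
      ring
    · rw [extVar_of_lt _ (by omega : n + 2 < e)]
      simpa only [map_mul] using hL (mem_L_three (K := K) he h4 (by omega))
  · intro h4
    rw [extVar_of_lt _ (by omega : 0 < e), extVar_of_lt _ (by omega : 2 < e),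
      extVar_of_lt _ (by omega : n - 2 < e), extVar_of_lt _ (by omega : n + 1 < e),
      extVar_of_lt _ (by omega : e - 1 < e)]
    simpa only [map_mul] using hL (mem_L_cubic (K := K) he h4 hne)
  · rintro rfl
    rw [extVar_of_lt _ (by omega : 2 < e), extVar_of_lt _ (by omega : 7 < e),
      extVar_of_lt _ (by omega : e - 1 < e)]
    simpa only [map_mul, map_pow] using hL (mem_L_cube (K := K) (e := e))

end

/-! ### Proof of the theorem -/

variable {K : Type*} [Field K] {e n : ℕ}

theorem mon_cons (i : ℕ) (s : Multiset ℕ) : mon K e n (i ::ₘ s) = x K e 1 n i * mon K e n s := by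
  simp [mon]

theorem x_of_valid {i : ℕ} (h : i < e ∧ i ≠ 1 ∧ i ≠ n) :
    x K e 1 n i = X (⟨i, h⟩ : Idx e 1 n) := dif_pos h

section Irredundancy

theorem rename_mon {s : Multiset ℕ} (hs : ∀ i ∈ s, i < e ∧ i ≠ 1 ∧ i ≠ n) :
    rename Subtype.val (mon K e n s) = monomial (Multiset.toFinsupp s) (1 : K) := by
  induction s using Multiset.induction with
  | empty => simp [mon]
  | cons i s ih =>
    rw [mon_cons, map_mul, ih fun j hj => hs j (Multiset.mem_cons_of_mem hj),
      x_of_valid (hs i (Multiset.mem_cons_self i s)), rename_X, ← Multiset.singleton_add, map_add,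
      Multiset.toFinsupp_singleton, monomial_single_add, pow_one]

theorem coeff_rename_binomial {a b : ℕ} {t : Multiset ℕ} {s : Bool} (he : 10 ≤ e) (hn : 2 ≤ n)
    (hne : n + 2 ≤ e) (h : Fam e n a b t s) (u : Multiset ℕ) :
    coeff (Multiset.toFinsupp u) (rename Subtype.val (binomial K e n a b t s)) =
      if s then (if lead a b = u then 1 else 0) - (if t = u then 1 else 0)
      else (if t = u then 1 else 0) - (if lead a b = u then 1 else 0) := by
  classical
  obtain ⟨h1, h2⟩ := h.valid he hn hne
  unfold binomial
  cases s <;>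
    simp only [if_true, Bool.false_eq_true, if_false, map_sub, coeff_sub, rename_mon h1,
      rename_mon h2, coeff_monomial, EmbeddingLike.apply_eq_iff_eq]

theorem eq_or_eq_of_coeff_ne_zero {a b : ℕ} {t : Multiset ℕ} {s : Bool} (he : 10 ≤ e) (hn : 2 ≤ n)
    (hne : n + 2 ≤ e) (h : Fam e n a b t s) {u : Multiset ℕ}
    (hu : coeff (Multiset.toFinsupp u) (rename Subtype.val (binomial K e n a b t s)) ≠ 0) :
    lead a b = u ∨ t = u := by
  by_contra hcon
  rw [not_or] at hcon
  rw [coeff_rename_binomial he hn hne h, if_neg hcon.1, if_neg hcon.2] at hu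
  simp at hu

/-- No generator lies in the ideal spanned by other ones. The polynomials are compared in the
polynomial ring over all `x_i`, `i ∈ ℕ`. -/
theorem mem_of_mem_span {G : Set (R K e 1 n)} (he : 10 ≤ e) (hn : 2 ≤ n) (hne : n + 2 ≤ e)
    (hG : G ⊆ J K e n ∪ Kset K e n ∪ L K e n) {f : R K e 1 n}
    (hf : f ∈ J K e n ∪ Kset K e n ∪ L K e n) (hfG : f ∈ Ideal.span G) : f ∈ G := by
  obtain ⟨a, b, t, s, hF, rfl⟩ := exists_fam_of_mem he hn hne hf
  let P : Set (ℕ × ℕ × Multiset ℕ × Bool) := {p | Fam e n p.1 p.2.1 p.2.2.1 p.2.2.2}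
  let g : ℕ × ℕ × Multiset ℕ × Bool → MvPolynomial ℕ K := fun p =>
    rename Subtype.val (binomial K e n p.1 p.2.1 p.2.2.1 p.2.2.2)
  have hmem : g (a, b, t, s) ∈ Ideal.span (rename Subtype.val '' G) := by
    have := Ideal.mem_map_of_mem (rename Subtype.val : R K e 1 n →ₐ[K] MvPolynomial ℕ K) hfG
    rwa [Ideal.map_span] at this
  have hsub : rename Subtype.val '' G ⊆ g '' P := by
    rintro _ ⟨f, hf, rfl⟩
    obtain ⟨a, b, t, s, hF, rfl⟩ := exists_fam_of_mem he hn hne (hG hf)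
    exact ⟨(a, b, t, s), hF, rfl⟩
  have key := mem_of_mem_span_of_triangular (P := P) (g := g)
    (l := fun p => Multiset.toFinsupp (lead p.1 p.2.1)) (w := fun p => weight e p.1 p.2.1)
    ?_ ?_ ?_ hsub hF hmem
  · obtain ⟨f, hf, hfe⟩ := key
    rwa [← rename_injective _ Subtype.val_injective hfe]
  · rintro ⟨a, b, t, s⟩ hp
    have hne' : t ≠ lead a b := fun h => (hp.weight_lt he hn hne hp h.symm).false
    dsimp only [g]
    rw [coeff_rename_binomial he hn hne hp, if_pos rfl, if_neg hne']
    cases s <;> simp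
  · rintro ⟨a, b, t, s⟩ (hp : Fam e n a b t s) ⟨a', b', t', s'⟩ (hq : Fam e n a' b' t' s') hpq hc
    rcases eq_or_eq_of_coeff_ne_zero he hn hne hq hc with h | h
    · dsimp only at h
      obtain ⟨rfl, rfl⟩ := lead_injective (Fam.le he hne hq) (Fam.le he hne hp) h
      obtain ⟨rfl, rfl⟩ := Fam.unique he hne hp hq
      exact absurd rfl hpq
    · exact Fam.weight_lt he hn hne hp hq h.symm
  · rintro ⟨a, b, t, s⟩ hp ⟨a', b', t', s'⟩ hq m hm
    by_contra hc
    obtain ⟨u, rfl⟩ := Multiset.toFinsupp.surjective m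
    have hm' : u < lead a b := Finsupp.orderIsoMultiset.symm.lt_iff_lt.1 hm
    have := Fam.not_lt_lead he hn hne hp hq
    rcases eq_or_eq_of_coeff_ne_zero he hn hne hq hc with rfl | rfl
    · exact this.1 hm'
    · exact this.2 hm'

end Irredundancy

section Generation

theorem exists_toSemigroupRing_mon {s : Multiset ℕ} (hs : ∀ i ∈ s, i < e ∧ i ≠ 1 ∧ i ≠ n) :
    ∃ d : S e 1 n, (d : ℕ) = e * s.card + s.sum ∧
      toSemigroupRing K e 1 n (mon K e n s) = AddMonoidAlgebra.single d 1 := by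
  induction s using Multiset.induction with
  | empty => exact ⟨0, by simp, by rw [mon, Multiset.map_zero, Multiset.prod_zero, map_one]; rfl⟩
  | cons i s ih =>
    obtain ⟨d, hd, hsd⟩ := ih fun j hj => hs j (Multiset.mem_cons_of_mem hj)
    refine ⟨⟨e + i, add_mem_S ⟨i, hs i (Multiset.mem_cons_self i s)⟩⟩ + d, ?_, ?_⟩
    · simp [hd]
      ring
    · rw [mon_cons, map_mul, hsd, x_of_valid (hs i (Multiset.mem_cons_self i s)), toSemigroupRing,
        aeval_X, AddMonoidAlgebra.single_mul_single, one_mul]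

theorem span_le_definingIdeal (he : 10 ≤ e) (hn : 2 ≤ n) (hne : n + 2 ≤ e) :
    Ideal.span (J K e n ∪ Kset K e n ∪ L K e n) ≤ definingIdeal K e 1 n := by
  refine Ideal.span_le.2 fun f hf => ?_
  obtain ⟨a, b, t, s, hF, rfl⟩ := exists_fam_of_mem he hn hne hf
  obtain ⟨h1, h2⟩ := hF.valid he hn hne
  obtain ⟨d, hd, hdl⟩ := exists_toSemigroupRing_mon (K := K) h1
  obtain ⟨d', hd', hdt⟩ := exists_toSemigroupRing_mon (K := K) h2
  obtain rfl : d = d' := Subtype.ext (by rw [hd, hd', hF.degree_eq he hn hne])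
  rw [SetLike.mem_coe, definingIdeal, RingHom.mem_ker, binomial]
  split_ifs <;> rw [map_sub, hdl, hdt, sub_self]

/-- Modulo relations `Rels`, every monomial takes the value of the normal form of its degree. -/
theorem exists_isNF_monomial (he : 10 ≤ e) (hn : 2 ≤ n) (hne : n + 2 ≤ e) {Q : Type*} [CommRing Q]
    (φ : R K e 1 n →+* Q) (h : Rels e n (extVar φ)) (m : Idx e 1 n →₀ ℕ) :
    ∃ d : S e 1 n, toSemigroupRing K e 1 n (monomial m 1) = AddMonoidAlgebra.single d 1 ∧
      IsNF e n (extVar φ) d (φ (monomial m 1)) := by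
  classical
  obtain ⟨s, rfl⟩ := Multiset.toFinsupp.surjective m
  induction s using Multiset.induction with
  | empty =>
    refine ⟨0, ?_, ?_⟩
    · rw [map_zero, ← MvPolynomial.one_def, map_one, AddMonoidAlgebra.one_def]
    · rw [map_zero, ← MvPolynomial.one_def, map_one]
      exact isNF_one (by omega) _
  | cons i s ih =>
    obtain ⟨d, hd, hnf⟩ := ih
    refine ⟨⟨e + i.1, add_mem_S i⟩ + d, ?_, ?_⟩
    · rw [← Multiset.singleton_add, map_add, Multiset.toFinsupp_singleton, monomial_single_add,
        pow_one, map_mul, hd, toSemigroupRing, aeval_X, AddMonoidAlgebra.single_mul_single, one_mul]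
    · rw [← Multiset.singleton_add, map_add, Multiset.toFinsupp_singleton, monomial_single_add,
        pow_one, map_mul, ← x_eq_X K i, ← extVar_of_lt φ i.2.1]
      exact h.isNF_var_mul he hn hne i.2.1 i.2.2.1 i.2.2.2 hnf

theorem definingIdeal_le_span (he : 10 ≤ e) (hn : 2 ≤ n) (hne : n + 2 ≤ e) :
    definingIdeal K e 1 n ≤ Ideal.span (J K e n ∪ Kset K e n ∪ L K e n) := by
  classical
  set I := Ideal.span (J K e n ∪ Kset K e n ∪ L K e n) with hI
  have hrel := rels_extVar he hn hne (Ideal.Quotient.mk I)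
    fun f hf => Ideal.Quotient.eq_zero_iff_mem.2 (Ideal.subset_span hf)
  -- As monomials of equal degree agree modulo `I`, the quotient map factors, as a linear map,
  -- through the semigroup ring.
  let N : S e 1 n → R K e 1 n ⧸ I := fun d =>
    if h : ∃ z, IsNF e n (extVar (Ideal.Quotient.mk I)) d z then h.choose else 0
  let Λ : AddMonoidAlgebra K (S e 1 n) →ₗ[K] R K e 1 n ⧸ I :=
    Finsupp.linearCombination K N ∘ₗ (AddMonoidAlgebra.coeffLinearEquiv K).toLinearMap
  have hΛ : Λ ∘ₗ (toSemigroupRing K e 1 n).toLinearMap = (Ideal.Quotient.mkₐ K I).toLinearMap := by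
    ext m
    obtain ⟨d, hd, hnf⟩ := exists_isNF_monomial he hn hne _ hrel m
    have hex : ∃ z, IsNF e n (extVar (Ideal.Quotient.mk I)) d z := ⟨_, hnf⟩
    have hN : N d = Ideal.Quotient.mk I (monomial m 1) := by
      dsimp only [N]
      rw [dif_pos hex]
      exact hex.choose_spec.unique hnf
    change Λ (toSemigroupRing K e 1 n (monomial m 1)) = Ideal.Quotient.mk I (monomial m 1)
    rw [hd, ← hN]
    simp [Λ]
  intro f hf
  have h0 : toSemigroupRing K e 1 n f = 0 := hf
  have := LinearMap.congr_fun hΛ f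
  simp only [LinearMap.comp_apply, AlgHom.toLinearMap_apply, h0, map_zero] at this
  exact Ideal.Quotient.eq_zero_iff_mem.1 this.symm

end Generation

end SallyType

theorem mainTheorem5 (K : Type*) [Field K] [IsAlgClosed K] [CharZero K]
    (e n : ℕ) (he : 10 ≤ e) (hn2 : 2 ≤ n) (hne : n ≤ e - 2) :
    Minimal (fun G : Set (SallyType.R K e 1 n) =>
        Ideal.span G = SallyType.definingIdeal K e 1 n)
      (SallyType.J K e n ∪ SallyType.Kset K e n ∪ SallyType.L K e n) := by
  have hne' : n + 2 ≤ e := by omega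
  have hspan := le_antisymm (SallyType.span_le_definingIdeal (K := K) he hn2 hne')
    (SallyType.definingIdeal_le_span he hn2 hne')
  refine ⟨hspan, fun G hG hsub f hf => ?_⟩
  refine SallyType.mem_of_mem_span he hn2 hne' hsub hf ?_
  rw [hG, ← hspan]
  exact Ideal.subset_span hf
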